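/- Let $\mathcal C$ be a category. A source $(m_j\colon B\to X_j)_{j\in J}$ in $\mathcal C$ is a \emph{mono-source} if for all $r,s\colon Z\to B$, $m_jr=m_js$ for all $j\in J$ implies $r=s$. We say that $\mathcal C$ has \emph{regular factorizations} if every source $(f_j\colon A\to X_j)_{j\in J}$ (with $J$ possibly empty or a proper class) can be written as $f_j=m_j\circ e$ with $e\colon A\to B$ a regular epimorphism and $(m_j)_{j\in J}$ a mono-source. A functor $U\colon\mathcal D\to\mathcal C$ is \emph{regularly monadic} if it has a left adjoint and, for every left adjoint, the comparison functor from $\mathcal D$ to the category of Eilenberg--Moore algebras of the associated monad $\mathbb T$ on $\mathcal C$ is an isomorphism of categories, and $\mathbb T$ is regular, that is, $\mathcal C$ has regular factorizations and $\mathbb T$ maps regular epimorphisms to regular epimorphisms. \textbf{Proposition.} Let $\mathcal C$ be a monoidal category with regular factorizations and denumerable (i.e. $\mathbb N$-indexed) coproducts, and assume that, for each object $C$ of $\mathcal C$, the functors $C\otimes-$ and $-\otimes C$ preserve these coproducts and preserve regular epimorphisms. Let $\mathbf{Mon}\,\mathcal C$ be the category of monoids in $\mathcal C$ and $|-|\colon\mathbf{Mon}\,\mathcal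 C\to\mathcal C$ the forgetful functor. Then: (1) $|-|$ has a left adjoint $F$ given by the standard free monoids: with $X^{\otimes 0}=I$ and $X^{\otimes (n+1)}=X^{\otimes n}\otimes X$, there are morphisms $\iota_n^X\colon X^{\otimes n}\to|FX|$ ($n\ge 0$) that exhibit $|FX|$ as the coproduct $\coprod_{n\ge0}X^{\otimes n}$; the unit of the monoid $FX$ is $\iota_0^X$; its multiplication $\mu$ satisfies $\mu\circ(\iota^X_m\otimes\iota^X_n)=\iota^X_{m+n}\circ\gamma_{m,n}$, where $\gamma_{m,n}\colon X^{\otimes m}\otimes X^{\otimes n}\cong X^{\otimes(m+n)}$ is the canonical isomorphism; $|Ff|=\coprod_{n\ge0} f^{\otimes n}$ for every morphism $f$, that is, $|Ff|\circ\iota^X_n=\iota^Y_n\circ f^{\otimes n}$ for $f\colon X\to Y$; and the unit of the adjunction at $X$ is $\iota^X_1$ (up to the canonical isomorphism $X\cong X^{\otimes 1}=I\otimes X$). (2) $|-|$ is regularly monadic; in particular the monad $\mathbb T=|F-|$ of (1) maps regular epimorphisms to regular epimorphisms. -/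

import Mathlib

open CategoryTheory CategoryTheory.Limits CategoryTheory.MonoidalCategory

universe v u v' u'

namespace RegularMonadicity

section Factorizations

variable {C : Type u} [Category.{v} C]

/-- A source `(m i : B ⟶ X i)` is a mono-source if it is jointly left-cancellable. The index type
may be arbitrary; in particular the empty source is allowed. -/
def IsMonoSource {B : C} {J : Type*} {X : J → C} (m : ∀ j, B ⟶ X j) : Prop :=
  ∀ ⦃Z : C⦄ (r s : Z ⟶ B), (∀ j, r ≫ m j = s ≫ m j) → r = s

variable (C) in
/-- `C` has regular factorizations: each source in `C` is a regular epimorphism followed by a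
mono-source. The universe of the index type is that of all morphisms of `C` with a given domain,
so that class-indexed sources are included. -/
def HasRegularFactorizations : Prop :=
  ∀ (A : C) (J : Type (max u v)) (X : J → C) (f : ∀ j, A ⟶ X j),
    ∃ (B : C) (e : A ⟶ B) (m : ∀ j, B ⟶ X j),
      IsRegularEpi e ∧ IsMonoSource m ∧ ∀ j, e ≫ m j = f j

/-- The functor `T` maps regular epimorphisms to regular epimorphisms. -/
def PreservesRegularEpis {D : Type u'} [Category.{v'} D] (T : C ⥤ D) : Prop :=
  ∀ ⦃X Y : C⦄ (f : X ⟶ Y), IsRegularEpi f → IsRegularEpi (T.map f)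

/-- A monad on `C` is regular if `C` has regular factorizations and the underlying endofunctor
preserves regular epimorphisms. -/
def IsRegularMonad (T : Monad C) : Prop :=
  HasRegularFactorizations C ∧ PreservesRegularEpis T.toFunctor

/-- A functor `U` is regularly monadic if it has a left adjoint and, for every left adjoint,
the comparison functor into the category of algebras of the associated monad is an isomorphism of
categories (bijective on objects, full and faithful) and this monad is regular. -/
def IsRegularlyMonadic {D : Type u'} [Category.{v'} D] (U : D ⥤ C) : Prop :=
  U.IsRightAdjoint ∧
    ∀ (F : C ⥤ D) (adj : F ⊣ U),
      (Monad.comparison adj).IsIso ∧ IsRegularMonad adj.toMonad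

end Factorizations

section FreeMonoid

variable {C : Type u} [Category.{v} C] [MonoidalCategory C]

variable (C) in
/-- For each object `X` the functors `X ⊗ -` and `- ⊗ X` preserve denumerable coproducts. -/
def TensorPreservesDenumerableCoproducts : Prop :=
  ∀ X : C, PreservesColimitsOfShape (Discrete ℕ) (tensorLeft X) ∧
    PreservesColimitsOfShape (Discrete ℕ) (tensorRight X)

variable (C) in
/-- For each object `X` the functors `X ⊗ -` and `- ⊗ X` preserve regular epimorphisms. -/
def TensorPreservesRegularEpis : Prop :=
  ∀ X : C, PreservesRegularEpis (tensorLeft X) ∧ PreservesRegularEpis (tensorRight X)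

/-- The `n`-fold tensor power of `X`, bracketed to the left and starting with the unit object. -/
def tensorPow (X : C) : ℕ → C
  | 0 => 𝟙_ C
  | n + 1 => tensorPow X n ⊗ X

/-- The `n`-fold tensor power of a morphism. -/
def tensorPowMap {X Y : C} (f : X ⟶ Y) : ∀ n : ℕ, tensorPow X n ⟶ tensorPow Y n
  | 0 => 𝟙 (𝟙_ C)
  | n + 1 => tensorPowMap f n ⊗ₘ f

/-- The canonical isomorphism between `X^m ⊗ X^n` and `X^(m+n)`. -/
def tensorPowAdd (X : C) (m : ℕ) : ∀ n : ℕ, tensorPow X m ⊗ tensorPow X n ≅ tensorPow X (m + n)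
  | 0 => ρ_ (tensorPow X m)
  | n + 1 => (α_ (tensorPow X m) (tensorPow X n) X).symm ≪≫
      whiskerRightIso (tensorPowAdd X m n) X

/-- The monoid `A` is the standard free monoid on `X` with respect to the morphisms
`i n : X^n ⟶ A`: these present the underlying object of `A` as the coproduct of all tensor
powers of `X`, the unit is the injection of the power zero, and the multiplication is given by
concatenation of tensor powers. -/
structure IsStandardFreeMonoid (X : C) (A : Mon C) (i : ∀ n : ℕ, tensorPow X n ⟶ A.X) : Prop where
  coproduct : Nonempty (IsColimit (Cofan.mk A.X i))
  unit : MonObj.one (X := A.X) = i 0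
  mul : ∀ m n : ℕ,
    (i m ⊗ₘ i n) ≫ MonObj.mul (X := A.X) = (tensorPowAdd X m n).hom ≫ i (m + n)

/-- The adjunction `adj` is the standard free monoid adjunction: `F` sends objects to standard
free monoids, it acts on a morphism `f` as the coproduct of the tensor powers of `f`, and the unit
of `adj` is the injection of the power one. -/
def IsStandardFreeMonoidAdjunction {F : C ⥤ Mon C} (adj : F ⊣ Mon.forget C) : Prop :=
  ∃ i : ∀ (X : C) (n : ℕ), tensorPow X n ⟶ (F.obj X).X,
    (∀ X : C, IsStandardFreeMonoid X (F.obj X) (i X)) ∧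
    (∀ ⦃X Y : C⦄ (f : X ⟶ Y) (n : ℕ), i X n ≫ (F.map f).hom = tensorPowMap f n ≫ i Y n) ∧
    ∀ X : C, adj.unit.app X = (λ_ X).inv ≫ i X 1

end FreeMonoid

end RegularMonadicity

/-! Monadicity needs no coproducts and is checked by hand for an arbitrary left adjoint `F`. The
structure map `a` of an algebra `A` is split in `C` by the unit of the adjunction, and the algebra
laws make the multiplication of `F A` compatible with the resulting idempotent. Hence `A` inherits a
monoid structure for which `a` is a homomorphism, and so `a` is the counit (`exists_counitHom_eq`).
The same splitting shows that algebra homomorphisms are monoid homomorphisms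
(`isMonHom_of_algebraHom`).

For the existence of `F`, concatenation of tensor powers makes their coproduct a monoid, because
tensoring preserves the coproduct in each variable. Every injection is a power of the one in degree
one (`eq_mulPow`), so homomorphisms out of this monoid correspond to morphisms out of `X`.

For regularity, regular epimorphisms need not be closed under composition, whereas strong ones are,
and strong ones are also closed under coproducts. Regular factorizations make the two classes
coincide, so coproducts of tensor powers of a regular epimorphism are again regular. -/

namespace RegularMonadicity

open MonObj

/-! ### Eilenberg–Moore algebras are monoids -/

section Monadicity

variable {C : Type u} [Category.{v} C] [MonoidalCategory C]

/-- A section of a monoid homomorphism in `C` computes the multiplication of the codomain. -/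
lemma section_mul {A B : C} [MonObj A] [MonObj B] (q : A ⟶ B) [IsMonHom q] (s : B ⟶ A)
    (h : s ≫ q = 𝟙 B) : (s ⊗ₘ s) ≫ μ ≫ q = μ := by
  rw [IsMonHom.mul_hom, tensorHom_comp_tensorHom_assoc, h]
  simp

/-- A split epimorphism `q` from a monoid induces a monoid structure on its codomain if `q` is
compatible with the multiplication up to the idempotent `q ≫ s`. -/
abbrev monObjOfSection {A B : C} [MonObj A] (q : A ⟶ B) (s : B ⟶ A) (h : s ≫ q = 𝟙 B)
    (hq : ((q ≫ s) ⊗ₘ (q ≫ s)) ≫ μ ≫ q = μ ≫ q) : MonObj B where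
  one := η ≫ q
  mul := (s ⊗ₘ s) ≫ μ ≫ q
  one_mul := by
    -- Every functor preserves split epimorphisms, so tensoring `q` gives epimorphisms without any
    -- assumption on `C`, and each monoid law can be tested on `A`.
    have hs : IsSplitEpi (𝟙_ C ◁ q) := ⟨⟨⟨𝟙_ C ◁ s, by rw [← whiskerLeft_comp, h, whiskerLeft_id]⟩⟩⟩
    rw [← cancel_epi (𝟙_ C ◁ q)]
    calc 𝟙_ C ◁ q ≫ (η ≫ q) ▷ B ≫ (s ⊗ₘ s) ≫ μ ≫ q
        = η ▷ A ≫ ((q ≫ s) ⊗ₘ (q ≫ s)) ≫ μ ≫ q := by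
          simp only [← id_tensorHom, ← tensorHom_id, tensorHom_comp_tensorHom_assoc,
            Category.id_comp, Category.assoc]
      _ = _ := by rw [hq]; simp
  mul_one := by
    have hs : IsSplitEpi (q ▷ 𝟙_ C) := ⟨⟨⟨s ▷ 𝟙_ C, by rw [← comp_whiskerRight, h, id_whiskerRight]⟩⟩⟩
    rw [← cancel_epi (q ▷ 𝟙_ C)]
    calc q ▷ 𝟙_ C ≫ B ◁ (η ≫ q) ≫ (s ⊗ₘ s) ≫ μ ≫ q
        = A ◁ η ≫ ((q ≫ s) ⊗ₘ (q ≫ s)) ≫ μ ≫ q := by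
          simp only [← id_tensorHom, ← tensorHom_id, tensorHom_comp_tensorHom_assoc,
            Category.id_comp, Category.assoc]
      _ = _ := by rw [hq]; simp
  mul_assoc := by
    have key : (q ⊗ₘ q) ≫ (s ⊗ₘ s) ≫ μ ≫ q = μ ≫ q := by
      rw [tensorHom_comp_tensorHom_assoc, hq]
    have h3 : (s ⊗ₘ s ⊗ₘ s) ≫ (q ⊗ₘ q ⊗ₘ q) = 𝟙 _ := by simp [h]
    have h3' : ((s ⊗ₘ s) ⊗ₘ s) ≫ ((q ⊗ₘ q) ⊗ₘ q) = 𝟙 _ := by simp [h]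
    have hs : IsSplitEpi ((q ⊗ₘ q) ⊗ₘ q) := ⟨⟨⟨_, h3'⟩⟩⟩
    rw [← cancel_epi ((q ⊗ₘ q) ⊗ₘ q)]
    have l : ((q ⊗ₘ q) ⊗ₘ q) ≫ ((s ⊗ₘ s) ≫ μ ≫ q) ▷ B = (μ ▷ A) ≫ (q ⊗ₘ q) := by
      rw [← tensorHom_id, tensorHom_comp_tensorHom, key, ← tensorHom_id,
        tensorHom_comp_tensorHom]
      simp
    have r : (q ⊗ₘ q ⊗ₘ q) ≫ B ◁ ((s ⊗ₘ s) ≫ μ ≫ q) = (A ◁ μ) ≫ (q ⊗ₘ q) := by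
      rw [← id_tensorHom, tensorHom_comp_tensorHom, key, ← id_tensorHom,
        tensorHom_comp_tensorHom]
      simp
    rw [reassoc_of% l, key, associator_naturality_assoc, reassoc_of% r, key]
    simp

variable {F : C ⥤ Mon C} (adj : F ⊣ Mon.forget C)

/-- The unit of an adjunction with right adjoint `Mon.forget C`, as a morphism of `C`. -/
abbrev unitHom (X : C) : X ⟶ (F.obj X).X := adj.unit.app X

/-- The counit of an adjunction with right adjoint `Mon.forget C`. -/
abbrev counitHom (M : Mon C) : F.obj M.X ⟶ M := adj.counit.app M

lemma unitHom_counitHom (M : Mon C) : unitHom adj M.X ≫ (counitHom adj M).hom = 𝟙 M.X :=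
  adj.right_triangle_components M

lemma unitHom_naturality {X Y : C} (f : X ⟶ Y) :
    f ≫ unitHom adj Y = unitHom adj X ≫ (F.map f).hom :=
  adj.unit.naturality f

lemma eq_counitHom {M : Mon C} (f : F.obj M.X ⟶ M) (hf : unitHom adj M.X ≫ f.hom = 𝟙 M.X) :
    counitHom adj M = f :=
  (adj.homEquiv M.X M).injective <| by
    refine (adj.homEquiv_unit (f := counitHom adj M)).trans
      (Eq.trans ?_ (adj.homEquiv_unit (f := f)).symm)
    exact (unitHom_counitHom adj M).trans hf.symm

/-- Algebra homomorphisms between monoids are monoid homomorphisms. -/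
lemma isMonHom_of_algebraHom {M N : Mon C} (f : M.X ⟶ N.X)
    (h : (F.map f).hom ≫ (counitHom adj N).hom = (counitHom adj M).hom ≫ f) : IsMonHom f := by
  have hc : IsMonHom ((counitHom adj M).hom ≫ f) :=
    h ▸ inferInstanceAs (IsMonHom (F.map f ≫ counitHom adj N).hom)
  have hu := unitHom_counitHom adj M
  generalize unitHom adj M.X = s at hu
  generalize counitHom adj M = q at *
  -- Both `q` and `q ≫ f` are homomorphisms, and `q` has a section `s` in `C`; precomposing with `s`
  -- or `s ⊗ₘ s` cancels `q`.
  refine ⟨?_, ?_⟩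
  · rw [← IsMonHom.one_hom q.hom, Category.assoc, IsMonHom.one_hom]
  · rw [← section_mul q.hom s hu, Category.assoc, Category.assoc,
      IsMonHom.mul_hom, tensorHom_comp_tensorHom_assoc, reassoc_of% hu]

instance comparison_full : (Monad.comparison adj).Full where
  map_surjective {M N} f := by
    have : IsMonHom (M := M.X) (N := N.X) f.f := isMonHom_of_algebraHom adj f.f f.h
    exact ⟨Mon.Hom.mk f.f, rfl⟩

lemma mon_ext_of_hom {M N : Mon C} (f : M ⟶ N) (hX : M.X = N.X) (hf : f.hom = eqToHom hX) :
    M = N := by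
  have h2 := IsMonHom.mul_hom f.hom
  rw [hf] at h2
  clear hf f
  obtain ⟨X⟩ := M
  obtain ⟨Y⟩ := N
  obtain rfl : X = Y := hX
  congr 1
  -- Multiplications suffice: the unit of a monoid is determined by its multiplication.
  exact MonObj.ext _ _ (by simpa using h2)

/-- By fullness, an equality of algebras lifts to a monoid homomorphism whose underlying morphism is
an identity up to transport. -/
lemma comparison_obj_injective : Function.Injective (Monad.comparison adj).obj := by
  intro M N h
  refine mon_ext_of_hom ((Monad.comparison adj).preimage (eqToHom h))
    (congrArg Monad.Algebra.A h) ?_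
  have hg : (adj.toMonad.forget).map
      ((Monad.comparison adj).map ((Monad.comparison adj).preimage (eqToHom h))) =
      eqToHom (congrArg Monad.Algebra.A h) := by
    rw [Functor.map_preimage, eqToHom_map]; rfl
  exact hg

/-- The structure morphism of an algebra is the counit at a monoid structure on its carrier. -/
lemma exists_counitHom_eq {A : C} (a : (F.obj A).X ⟶ A) (hu : unitHom adj A ≫ a = 𝟙 A)
    (ha : (counitHom adj (F.obj A)).hom ≫ a = (F.map a).hom ≫ a) :
    ∃ m : MonObj A, (counitHom adj (@Mon.mk C _ _ A m)).hom = a := by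
  have hq : ((a ≫ unitHom adj A) ⊗ₘ (a ≫ unitHom adj A)) ≫ μ ≫ a = μ ≫ a := by
    have hc := unitHom_counitHom adj (F.obj A)
    -- By naturality `a ≫ unitHom adj A` becomes the unit at `F A` followed by `F.map a`. The
    -- homomorphism `F.map a` passes through `μ`, the algebra law trades it for the counit `q`, and
    -- `q` passes back to cancel against the unit `s`.
    rw [unitHom_naturality]
    generalize unitHom adj (F.obj A).X = s at *
    generalize counitHom adj (F.obj A) = q at *
    rw [← tensorHom_comp_tensorHom, Category.assoc, ← IsMonHom.mul_hom_assoc, ← ha,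
      IsMonHom.mul_hom_assoc, tensorHom_comp_tensorHom_assoc, hc]
    simp
  let _ : MonObj A := monObjOfSection a (unitHom adj A) hu hq
  have : IsMonHom a := ⟨rfl, by
    change _ = (a ⊗ₘ a) ≫ (unitHom adj A ⊗ₘ unitHom adj A) ≫ μ ≫ a
    rw [tensorHom_comp_tensorHom_assoc, hq]⟩
  exact ⟨inferInstance, congrArg Mon.Hom.hom (eq_counitHom adj (M := Mon.mk A) (Mon.Hom.mk a) hu)⟩

lemma comparison_obj_surjective : Function.Surjective (Monad.comparison adj).obj := by
  rintro ⟨A, a, hu, ha⟩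
  obtain ⟨m, hm⟩ := exists_counitHom_eq adj a hu ha
  refine ⟨@Mon.mk C _ _ A m, ?_⟩
  subst hm
  rfl

/-- The comparison functor of every adjunction with right adjoint `Mon.forget C` is an
isomorphism of categories. -/
lemma comparison_isIso : (Monad.comparison adj).IsIso where
  bijective_obj := ⟨comparison_obj_injective adj, comparison_obj_surjective adj⟩

end Monadicity

end RegularMonadicity

namespace RegularMonadicity

open MonObj

/-! ### Coherence of tensor powers, and powers of a morphism into a monoid -/

section TensorPowers

variable {C : Type u} [Category.{v} C] [MonoidalCategory C]

lemma eqToHom_tensorPow {X A : C} (i : ∀ n, tensorPow X n ⟶ A) {m n : ℕ} (h : m = n) :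
    eqToHom (congrArg (tensorPow X) h) ≫ i n = i m := by
  subst h; simp

lemma eqToHom_tensor_right (P : ℕ → C) (X : C) {m n : ℕ} (h : m = n) :
    eqToHom (congrArg (fun n => P n ⊗ X) h) = eqToHom (congrArg P h) ▷ X := by
  subst h; simp

/-- Becomes the left unit law of the free monoid. The transport is needed because `0 + n` does not
reduce to `n`; the right unit law needs none, since `n + 0` does. -/
lemma tensorPowAdd_zero_left (X : C) : ∀ n : ℕ,
    (tensorPowAdd X 0 n).hom ≫ eqToHom (congrArg (tensorPow X) (Nat.zero_add n)) =
      (λ_ (tensorPow X n)).hom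
  | 0 => by
    change (ρ_ (𝟙_ C)).hom ≫ 𝟙 _ = (λ_ (𝟙_ C)).hom
    rw [Category.comp_id, unitors_equal]
  | n + 1 => by
    have ih := tensorPowAdd_zero_left X n
    change ((α_ (tensorPow X 0) (tensorPow X n) X).inv ≫ (tensorPowAdd X 0 n).hom ▷ X) ≫
      eqToHom (congrArg (fun n => tensorPow X n ⊗ X) (Nat.zero_add n)) =
      (λ_ (tensorPow X n ⊗ X)).hom
    rw [eqToHom_tensor_right (tensorPow X) X (Nat.zero_add n), Category.assoc, ← comp_whiskerRight, ih]
    exact (leftUnitor_tensor_hom _ _).symm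

/-- Becomes associativity of the free monoid. Induction is on the last exponent, the one on which
`tensorPowAdd` recurses. -/
lemma tensorPowAdd_assoc (X : C) (m n : ℕ) : ∀ k : ℕ,
    (tensorPowAdd X m n).hom ▷ tensorPow X k ≫ (tensorPowAdd X (m + n) k).hom ≫
        eqToHom (congrArg (tensorPow X) (Nat.add_assoc m n k)) =
      (α_ _ _ _).hom ≫ tensorPow X m ◁ (tensorPowAdd X n k).hom ≫
        (tensorPowAdd X m (n + k)).hom
  | 0 => by
    change (tensorPowAdd X m n).hom ▷ 𝟙_ C ≫ (ρ_ _).hom ≫ 𝟙 _ =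
      (α_ _ _ (𝟙_ C)).hom ≫ tensorPow X m ◁ (ρ_ _).hom ≫ (tensorPowAdd X m n).hom
    simp
  | k + 1 => by
    have ih := congrArg (· ▷ X) (tensorPowAdd_assoc X m n k)
    change (tensorPowAdd X m n).hom ▷ (tensorPow X k ⊗ X) ≫
        ((α_ _ _ _).inv ≫ (tensorPowAdd X (m + n) k).hom ▷ X) ≫
          eqToHom (congrArg (fun n => tensorPow X n ⊗ X) (Nat.add_assoc m n k)) =
      (α_ _ _ (tensorPow X k ⊗ X)).hom ≫
        tensorPow X m ◁ ((α_ _ _ _).inv ≫ (tensorPowAdd X n k).hom ▷ X) ≫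
        ((α_ _ _ _).inv ≫ (tensorPowAdd X m (n + k)).hom ▷ X)
    simp only [comp_whiskerRight, whisker_assoc, Category.assoc] at ih
    rw [eqToHom_tensor_right (tensorPow X) X (Nat.add_assoc m n k)]
    simp only [Category.assoc, associator_inv_naturality_left_assoc, ih]
    simp

/-- The `n`-fold product of a morphism into a monoid. -/
def mulPow {X M : C} [MonObj M] (f : X ⟶ M) : ∀ n : ℕ, tensorPow X n ⟶ M
  | 0 => η
  | n + 1 => (mulPow f n ⊗ₘ f) ≫ μ

/-- The exponent law for powers in a monoid; it makes the extension of `f` to the free monoid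
multiplicative. -/
lemma mulPow_add {X M : C} [MonObj M] (f : X ⟶ M) (m : ℕ) : ∀ n : ℕ,
    (mulPow f m ⊗ₘ mulPow f n) ≫ μ = (tensorPowAdd X m n).hom ≫ mulPow f (m + n)
  | 0 => by
    change (mulPow f m ⊗ₘ η) ≫ μ = (ρ_ _).hom ≫ mulPow f m
    rw [MonoidalCategory.tensorHom_def, Category.assoc, MonObj.mul_one, rightUnitor_naturality]
  | n + 1 => by
    have ih := mulPow_add f m n
    change (mulPow f m ⊗ₘ ((mulPow f n ⊗ₘ f) ≫ μ)) ≫ μ =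
      ((α_ _ _ _).inv ≫ (tensorPowAdd X m n).hom ▷ X) ≫ (mulPow f (m + n) ⊗ₘ f) ≫ μ
    rw [Category.assoc, ← tensorHom_id, tensorHom_comp_tensorHom_assoc, ← ih]
    calc (mulPow f m ⊗ₘ ((mulPow f n ⊗ₘ f) ≫ μ)) ≫ μ
        = (mulPow f m ⊗ₘ mulPow f n ⊗ₘ f) ≫ M ◁ μ ≫ μ := by
          rw [← id_tensorHom, tensorHom_comp_tensorHom_assoc, Category.comp_id]
      _ = (α_ _ _ _).inv ≫ ((mulPow f m ⊗ₘ mulPow f n) ⊗ₘ f) ≫ μ ▷ M ≫ μ := by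
          rw [MonObj.mul_assoc, associator_naturality_assoc, Iso.inv_hom_id_assoc]
      _ = _ := by
          rw [← tensorHom_id, tensorHom_comp_tensorHom_assoc, Category.comp_id, Category.id_comp]

lemma mulPow_comp {X M N : C} [MonObj M] [MonObj N] (f : X ⟶ M) (g : M ⟶ N) [IsMonHom g] :
    ∀ n : ℕ, mulPow f n ≫ g = mulPow (f ≫ g) n
  | 0 => IsMonHom.one_hom g
  | n + 1 => by
    change ((mulPow f n ⊗ₘ f) ≫ μ) ≫ g = (mulPow (f ≫ g) n ⊗ₘ f ≫ g) ≫ μ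
    rw [Category.assoc, IsMonHom.mul_hom, tensorHom_comp_tensorHom_assoc, mulPow_comp f g n]

lemma tensorPowMap_mulPow {X Y M : C} [MonObj M] (g : X ⟶ Y) (f : Y ⟶ M) :
    ∀ n : ℕ, tensorPowMap g n ≫ mulPow f n = mulPow (g ≫ f) n
  | 0 => Category.id_comp _
  | n + 1 => by
    change (tensorPowMap g n ⊗ₘ g) ≫ (mulPow f n ⊗ₘ f) ≫ μ = (mulPow (g ≫ f) n ⊗ₘ g ≫ f) ≫ μ
    rw [tensorHom_comp_tensorHom_assoc, tensorPowMap_mulPow g f n]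

/-- The canonical isomorphism between an object and its first tensor power. -/
def tensorPowOne (X : C) : X ≅ tensorPow X 1 := (λ_ X).symm

lemma tensorPowAdd_one (X : C) (n : ℕ) :
    tensorPow X n ◁ (tensorPowOne X).hom ≫ (tensorPowAdd X n 1).hom =
      𝟙 (tensorPow X n ⊗ X) := by
  change tensorPow X n ◁ (λ_ X).inv ≫
    (α_ (tensorPow X n) (𝟙_ C) X).inv ≫ (ρ_ (tensorPow X n)).hom ▷ X = _
  simp

lemma mulPow_one {X M : C} [MonObj M] (f : X ⟶ M) : (tensorPowOne X).hom ≫ mulPow f 1 = f := by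
  change (λ_ X).inv ≫ (η ⊗ₘ f) ≫ μ = f
  rw [tensorHom_def', Category.assoc, MonObj.one_mul, leftUnitor_naturality,
    Iso.inv_hom_id_assoc]

end TensorPowers

/-! ### Standard free monoids and their adjunction -/

section FreeMonoidConstruction

variable {C : Type u} [Category.{v} C] [MonoidalCategory C]

section

variable (hcoprod : TensorPreservesDenumerableCoproducts C) {P : ℕ → C} {A : C}
  {i : ∀ n, P n ⟶ A} (hi : IsColimit (Cofan.mk A i))

/-- Tensoring a denumerable coproduct from the left gives a coproduct. -/
noncomputable def isColimitWhiskerLeft (Z : C) :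
    IsColimit (Cofan.mk (Z ⊗ A) fun n => Z ◁ i n) :=
  haveI := (hcoprod Z).1
  isColimitCofanMkObjOfIsColimit (tensorLeft Z) _ i hi

/-- Tensoring a denumerable coproduct from the right gives a coproduct. -/
noncomputable def isColimitWhiskerRight (Z : C) :
    IsColimit (Cofan.mk (A ⊗ Z) fun n => i n ▷ Z) :=
  haveI := (hcoprod Z).2
  isColimitCofanMkObjOfIsColimit (tensorRight Z) _ i hi

include hcoprod hi

lemma tensor_hom_ext {Z : C} {f g : A ⊗ A ⟶ Z}
    (h : ∀ m n, (i m ⊗ₘ i n) ≫ f = (i m ⊗ₘ i n) ≫ g) : f = g := by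
  refine Cofan.IsColimit.hom_ext (isColimitWhiskerRight hcoprod hi A) _ _ fun m => ?_
  refine Cofan.IsColimit.hom_ext (isColimitWhiskerLeft hcoprod hi (P m)) _ _ fun n => ?_
  simpa [tensorHom_def'] using h m n

lemma tensor_tensor_hom_ext {Z : C} {f g : (A ⊗ A) ⊗ A ⟶ Z}
    (h : ∀ m n k, ((i m ⊗ₘ i n) ⊗ₘ i k) ≫ f = ((i m ⊗ₘ i n) ⊗ₘ i k) ≫ g) : f = g := by
  refine Cofan.IsColimit.hom_ext (isColimitWhiskerLeft hcoprod hi (A ⊗ A)) _ _ fun k => ?_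
  -- Only outer tensor factors can be expanded as coproducts, so reassociation brings the first
  -- factor outside; afterwards the middle one is reached by whiskering twice.
  rw [← cancel_epi (α_ _ _ _).inv]
  refine Cofan.IsColimit.hom_ext (isColimitWhiskerRight hcoprod hi (A ⊗ P k)) _ _ fun m => ?_
  rw [← cancel_epi (α_ _ _ _).hom]
  have hr := isColimitWhiskerRight hcoprod (isColimitWhiskerLeft hcoprod hi (P m)) (P k)
  refine Cofan.IsColimit.hom_ext hr _ _ fun n => ?_
  have w := h m n k
  rw [MonoidalCategory.tensorHom_def (i m ⊗ₘ i n), tensorHom_def' (i m)] at w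
  simpa using w

lemma exists_tensor_desc {Z : C} (f : ∀ m n, P m ⊗ P n ⟶ Z) :
    ∃ g : A ⊗ A ⟶ Z, ∀ m n, (i m ⊗ₘ i n) ≫ g = f m n := by
  refine ⟨Cofan.IsColimit.desc (isColimitWhiskerRight hcoprod hi A) fun m =>
    Cofan.IsColimit.desc (isColimitWhiskerLeft hcoprod hi (P m)) fun n => f m n, fun m n => ?_⟩
  rw [tensorHom_def', Category.assoc]
  erw [Cofan.IsColimit.fac (isColimitWhiskerRight hcoprod hi A),
    Cofan.IsColimit.fac (isColimitWhiskerLeft hcoprod hi (P m))]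

end

/-- Every denumerable coproduct of the tensor powers of `X` carries the structure of a standard
free monoid. -/
lemma exists_isStandardFreeMonoid [HasCoproductsOfShape ℕ C]
    (hcoprod : TensorPreservesDenumerableCoproducts C) (X : C) :
    ∃ (A : Mon C) (i : ∀ n, tensorPow X n ⟶ A.X), IsStandardFreeMonoid X A i := by
  let A : C := ∐ (tensorPow X)
  let i : ∀ n, tensorPow X n ⟶ A := Sigma.ι (tensorPow X)
  have hi : IsColimit (Cofan.mk A i) := coproductIsCoproduct (tensorPow X)
  clear_value A i
  obtain ⟨p, hp⟩ := exists_tensor_desc hcoprod hi fun m n => (tensorPowAdd X m n).hom ≫ i (m + n)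
  let _ : MonObj A :=
    { one := i 0
      mul := p
      one_mul := by
        refine Cofan.IsColimit.hom_ext (isColimitWhiskerLeft hcoprod hi (𝟙_ C)) _ _ fun n => ?_
        change 𝟙_ C ◁ i n ≫ i 0 ▷ A ≫ p = 𝟙_ C ◁ i n ≫ (λ_ A).hom
        have h := hp 0 n
        rw [tensorHom_def', Category.assoc] at h
        have h' := congrArg (· ≫ i n) (tensorPowAdd_zero_left X n)
        simp only [Category.assoc, eqToHom_tensorPow i (Nat.zero_add n)] at h'
        exact h.trans (h'.trans (leftUnitor_naturality (i n)).symm)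
      mul_one := by
        refine Cofan.IsColimit.hom_ext (isColimitWhiskerRight hcoprod hi (𝟙_ C)) _ _ fun n => ?_
        change i n ▷ 𝟙_ C ≫ A ◁ i 0 ≫ p = i n ▷ 𝟙_ C ≫ (ρ_ A).hom
        have h := hp n 0
        rw [MonoidalCategory.tensorHom_def, Category.assoc] at h
        exact h.trans (rightUnitor_naturality (i n)).symm
      mul_assoc := by
        refine tensor_tensor_hom_ext hcoprod hi fun m n k => ?_
        calc ((i m ⊗ₘ i n) ⊗ₘ i k) ≫ p ▷ A ≫ p
            = ((i m ⊗ₘ i n) ≫ p ⊗ₘ i k) ≫ p := by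
              rw [← tensorHom_id, tensorHom_comp_tensorHom_assoc, Category.comp_id]
          _ = (tensorPowAdd X m n).hom ▷ tensorPow X k ≫ (tensorPowAdd X (m + n) k).hom ≫
                i (m + n + k) := by
              rw [hp, ← hp (m + n) k, ← tensorHom_id, tensorHom_comp_tensorHom_assoc,
                Category.id_comp]
          _ = (α_ _ _ _).hom ≫ tensorPow X m ◁ (tensorPowAdd X n k).hom ≫
                (tensorPowAdd X m (n + k)).hom ≫ i (m + (n + k)) := by
              rw [← eqToHom_tensorPow i (Nat.add_assoc m n k)]
              simpa only [Category.assoc] using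
                congrArg (· ≫ i (m + (n + k))) (tensorPowAdd_assoc X m n k)
          _ = (α_ _ _ _).hom ≫ (i m ⊗ₘ (i n ⊗ₘ i k) ≫ p) ≫ p := by
              rw [hp, ← hp m (n + k), ← id_tensorHom, tensorHom_comp_tensorHom_assoc,
                Category.id_comp]
          _ = ((i m ⊗ₘ i n) ⊗ₘ i k) ≫ (α_ A A A).hom ≫ A ◁ p ≫ p := by
              rw [associator_naturality_assoc, ← id_tensorHom, tensorHom_comp_tensorHom_assoc,
                Category.comp_id] }
  exact ⟨Mon.mk A, i, ⟨hi⟩, rfl, hp⟩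

namespace IsStandardFreeMonoid

variable {X : C} {A : Mon C} {i : ∀ n, tensorPow X n ⟶ A.X} (h : IsStandardFreeMonoid X A i)

include h

/-- The rule for multiplying degrees `n` and `1` yields the injection of degree `n + 1`, so the
degree-one part generates the monoid. -/
lemma eq_mulPow : ∀ n : ℕ, i n = mulPow ((tensorPowOne X).hom ≫ i 1) n
  | 0 => h.unit.symm
  | n + 1 => by
    change _ = (mulPow ((tensorPowOne X).hom ≫ i 1) n ⊗ₘ ((tensorPowOne X).hom ≫ i 1)) ≫ μ
    have hm := congrArg (tensorPow X n ◁ (tensorPowOne X).hom ≫ ·) (h.mul n 1)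
    simp only [← id_tensorHom, tensorHom_comp_tensorHom_assoc, Category.id_comp] at hm
    rw [← eq_mulPow n, hm, id_tensorHom, ← Category.assoc, tensorPowAdd_one]
    exact (Category.id_comp _).symm

lemma hom_ext {Z : C} {f g : A.X ⟶ Z} (w : ∀ n, i n ≫ f = i n ≫ g) : f = g :=
  Cofan.IsColimit.hom_ext h.coproduct.some _ _ w

lemma monHom_ext {M : Mon C} {f g : A ⟶ M} (w : i 1 ≫ f.hom = i 1 ≫ g.hom) : f = g := by
  refine Mon.Hom.ext (h.hom_ext fun n => ?_)
  rw [h.eq_mulPow n, mulPow_comp, mulPow_comp, Category.assoc, Category.assoc, w]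

lemma exists_lift (hcoprod : TensorPreservesDenumerableCoproducts C) {M : Mon C} (f : X ⟶ M.X) :
    ∃ g : A ⟶ M, ∀ n, i n ≫ g.hom = mulPow f n := by
  let g : A.X ⟶ M.X := Cofan.IsColimit.desc h.coproduct.some (mulPow f)
  have hg : ∀ n, i n ≫ g = mulPow f n := fun n =>
    Cofan.IsColimit.fac h.coproduct.some (mulPow f) n
  have : IsMonHom g :=
    { one_hom := (congrArg (· ≫ g) h.unit).trans (hg 0)
      mul_hom := by
        refine tensor_hom_ext hcoprod h.coproduct.some fun m n => ?_
        rw [← Category.assoc, h.mul, Category.assoc, hg, tensorHom_comp_tensorHom_assoc, hg, hg,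
          mulPow_add] }
  exact ⟨Mon.Hom.mk g, hg⟩

/-- The universal property of a standard free monoid. -/
noncomputable def homEquiv (hcoprod : TensorPreservesDenumerableCoproducts C) (M : Mon C) :
    (A ⟶ M) ≃ (X ⟶ M.X) where
  toFun g := (tensorPowOne X).hom ≫ i 1 ≫ g.hom
  invFun f := (h.exists_lift hcoprod f).choose
  left_inv g := h.monHom_ext <| by
    rw [(h.exists_lift hcoprod _).choose_spec, ← cancel_epi (tensorPowOne X).hom, mulPow_one]
  right_inv f := by
    dsimp only
    rw [(h.exists_lift hcoprod f).choose_spec, mulPow_one]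

end IsStandardFreeMonoid

/-- The standard free monoids form a left adjoint of the forgetful functor. -/
lemma exists_standardFreeMonoidAdjunction [HasCoproductsOfShape ℕ C]
    (hcoprod : TensorPreservesDenumerableCoproducts C) :
    ∃ (F : C ⥤ Mon C) (adj : F ⊣ Mon.forget C), IsStandardFreeMonoidAdjunction adj := by
  choose A i h using exists_isStandardFreeMonoid (C := C) hcoprod
  let e : ∀ X M, (A X ⟶ M) ≃ (X ⟶ (Mon.forget C).obj M) := fun X M => (h X).homEquiv hcoprod M
  have he : ∀ X M N (g : M ⟶ N) (k : A X ⟶ M),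
      e X N (k ≫ g) = e X M k ≫ (Mon.forget C).map g := fun X M N g k => by
    change (tensorPowOne X).hom ≫ i X 1 ≫ k.hom ≫ g.hom =
      ((tensorPowOne X).hom ≫ i X 1 ≫ k.hom) ≫ g.hom
    simp only [Category.assoc]
  let adj := Adjunction.adjunctionOfEquivLeft (G := Mon.forget C) e he
  have hunit : ∀ X, adj.unit.app X = (tensorPowOne X).hom ≫ i X 1 := fun X =>
    (Adjunction.adjunctionOfEquivLeft_unit_app e he X).trans <| by
      change (tensorPowOne X).hom ≫ i X 1 ≫ 𝟙 (A X).X = _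
      rw [Category.comp_id]
  refine ⟨_, adj, i, h, fun X Y f n => ?_, hunit⟩
  have hn : f ≫ (tensorPowOne Y).hom ≫ i Y 1 =
      ((tensorPowOne X).hom ≫ i X 1) ≫ ((Adjunction.leftAdjointOfEquiv e he).map f).hom := by
    rw [← hunit, ← hunit]
    exact adj.unit.naturality f
  -- Both sides are `n`-th powers of morphisms out of `X`, so the degree-one case `hn`, which is
  -- naturality of the unit, is enough.
  rw [(h X).eq_mulPow n, (h Y).eq_mulPow n, tensorPowMap_mulPow, hn]
  exact mulPow_comp _ _ n

end FreeMonoidConstruction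

end RegularMonadicity

namespace RegularMonadicity

/-! ### Preservation of regular epimorphisms -/

section RegularEpis

variable {C : Type u} [Category.{v} C]

/-- In a category with regular factorizations strong epimorphisms are regular. -/
lemma HasRegularFactorizations.isRegularEpi_of_strongEpi (hfact : HasRegularFactorizations C)
    {X Y : C} (f : X ⟶ Y) [StrongEpi f] : IsRegularEpi f := by
  -- Factor the one-element source `f`: its mono part is also a strong epimorphism, hence
  -- invertible.
  obtain ⟨B, e, m, he, hm, hf⟩ := hfact X PUnit (fun _ => Y) fun _ => f
  have hf := hf ⟨⟩
  have : Mono (m ⟨⟩) := ⟨fun r s w => hm r s fun _ => w⟩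
  have : StrongEpi (e ≫ m ⟨⟩) := by rw [hf]; infer_instance
  have : StrongEpi (m ⟨⟩) := strongEpi_of_strongEpi e _
  have : IsIso (m ⟨⟩) := isIso_of_mono_of_strongEpi _
  rw [← hf]
  exact (MorphismProperty.cancel_right_of_respectsIso (.regularEpi C) e (m ⟨⟩)).2 he

/-- A coproduct of strong epimorphisms is a strong epimorphism. -/
lemma strongEpi_of_cofan {J : Type*} {P Q : J → C} {A B : C} {i : ∀ j, P j ⟶ A}
    {k : ∀ j, Q j ⟶ B} (hi : IsColimit (Cofan.mk A i)) (hk : IsColimit (Cofan.mk B k))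
    (q : ∀ j, P j ⟶ Q j) (hq : ∀ j, StrongEpi (q j)) (g : A ⟶ B)
    (hg : ∀ j, i j ≫ g = q j ≫ k j) : StrongEpi g := by
  have : Epi g := ⟨fun r s w => Cofan.IsColimit.hom_ext hk _ _ fun j => by
    change k j ≫ r = k j ≫ s
    rw [← cancel_epi (q j), ← reassoc_of% hg, w, reassoc_of% hg]⟩
  refine StrongEpi.mk' fun S T z hz a b sq => ?_
  have sq' : ∀ j, CommSq (i j ≫ a) (q j) z (k j ≫ b) := fun j =>
    ⟨by rw [Category.assoc, sq.w, reassoc_of% hg]⟩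
  let l : B ⟶ S := Cofan.IsColimit.desc hk fun j => (sq' j).lift
  have hl : ∀ j, k j ≫ l = (sq' j).lift := fun j => Cofan.IsColimit.fac hk _ j
  refine CommSq.HasLift.mk' ⟨l, ?_, ?_⟩
  · refine Cofan.IsColimit.hom_ext hi _ _ fun j => ?_
    change i j ≫ g ≫ l = i j ≫ a
    rw [reassoc_of% hg, hl, CommSq.fac_left]
  · refine Cofan.IsColimit.hom_ext hk _ _ fun j => ?_
    change k j ≫ l ≫ z = k j ≫ b
    rw [reassoc_of% hl, CommSq.fac_right]

variable [MonoidalCategory C]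

/-- The map `tensorPowMap f n ⊗ₘ f` is a composite of two whiskered maps. Whiskering is known to
preserve regular epimorphisms and composition preserves strong ones, so the induction passes between
the two classes. -/
lemma strongEpi_tensorPowMap (hepi : TensorPreservesRegularEpis C)
    (hfact : HasRegularFactorizations C) {X Y : C} (f : X ⟶ Y) [IsRegularEpi f] :
    ∀ n : ℕ, StrongEpi (tensorPowMap f n)
  | 0 => inferInstanceAs (StrongEpi (𝟙 (𝟙_ C)))
  | n + 1 => by
    have := strongEpi_tensorPowMap hepi hfact f n
    have h1 : IsRegularEpi (tensorPowMap f n ▷ X) :=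
      (hepi X).2 _ (hfact.isRegularEpi_of_strongEpi _)
    have h2 : IsRegularEpi (tensorPow Y n ◁ f) := (hepi (tensorPow Y n)).1 _ inferInstance
    change StrongEpi (tensorPowMap f n ⊗ₘ f)
    rw [MonoidalCategory.tensorHom_def]
    infer_instance

/-- The monad of standard free monoids preserves regular epimorphisms. -/
lemma IsStandardFreeMonoidAdjunction.preservesRegularEpis (hepi : TensorPreservesRegularEpis C)
    (hfact : HasRegularFactorizations C) {F : C ⥤ Mon C} {adj : F ⊣ Mon.forget C}
    (h : IsStandardFreeMonoidAdjunction adj) : PreservesRegularEpis (F ⋙ Mon.forget C) := by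
  obtain ⟨i, hi, hmap, -⟩ := h
  intro X Y f hf
  have : StrongEpi ((F ⋙ Mon.forget C).map f) :=
    strongEpi_of_cofan (hi X).coproduct.some (hi Y).coproduct.some (tensorPowMap f)
      (strongEpi_tensorPowMap hepi hfact f) _ (hmap f)
  exact hfact.isRegularEpi_of_strongEpi _

omit [MonoidalCategory C] in
lemma PreservesRegularEpis.of_iso {D : Type u'} [Category.{v'} D] {S T : C ⥤ D}
    (hS : PreservesRegularEpis S) (e : S ≅ T) : PreservesRegularEpis T := fun _ _ f hf =>
  ((MorphismProperty.regularEpi D).arrow_mk_iso_iff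
    (((Functor.mapArrowFunctor C D).mapIso e).app (Arrow.mk f))).1 (hS f hf)

end RegularEpis

end RegularMonadicity

theorem mainTheorem6 (C : Type u) [Category.{v} C] [MonoidalCategory C]
    [HasCoproductsOfShape ℕ C]
    (hfact : RegularMonadicity.HasRegularFactorizations C)
    (hcoprod : RegularMonadicity.TensorPreservesDenumerableCoproducts C)
    (hepi : RegularMonadicity.TensorPreservesRegularEpis C) :
    (∃ (F : C ⥤ Mon C) (adj : F ⊣ Mon.forget C),
      RegularMonadicity.IsStandardFreeMonoidAdjunction adj) ∧
    RegularMonadicity.IsRegularlyMonadic (Mon.forget C) := by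
  have hF := RegularMonadicity.exists_standardFreeMonoidAdjunction hcoprod
  refine ⟨hF, ?_⟩
  obtain ⟨F, adj, h⟩ := hF
  refine ⟨adj.isRightAdjoint, fun F' adj' =>
    ⟨RegularMonadicity.comparison_isIso adj', hfact, ?_⟩⟩
  -- Left adjoints are unique up to isomorphism, so regularity passes from the standard free monoid
  -- functor to an arbitrary `F'`.
  exact (h.preservesRegularEpis hepi hfact).of_iso
    (Functor.isoWhiskerRight (adj.leftAdjointUniq adj') (Mon.forget C))
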